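/- Graphs are finite multigraphs (loops and multiple edges allowed), and a bouquet is a graph with exactly one vertex. Let $p$ be a prime. An unramified $\mathbb{Z}_p$-covering $X_\infty/X$ is a tower $X = X_0 \leftarrow X_1 \leftarrow X_2 \leftarrow \cdots$ of unramified coverings of connected graphs such that, for every $n \ge 0$, the composite $X_n \to X$ is a Galois covering with Galois group isomorphic to $\mathbb{Z}/p^n\mathbb{Z}$. Write $\kappa_{X_n}$ for the number of spanning trees of $X_n$ and $\operatorname{ord}_l$ for the $l$-adic valuation. The invariants $\lambda_p(X_\infty/X)$ and $\mu_l(X_\infty/X)$ ($l$ prime) are the non-negative integers for which there are integers $\nu_l$ such that $$\operatorname{ord}_p(\kappa_{X_n}) = \lambda_p(X_\infty/X)\, n + \mu_p(X_\infty/X)\, p^n + \nu_p \quad\text{for all sufficiently large } n,$$ and, for every prime $l \ne p$, $$\operatorname{ord}_l(\kappa_{X_n}) = \mu_l(X_\infty/X)\, p^n + \nu_l \quad\text{for all sufficiently large } n$$ (where "sufficiently large" may depend on $l$). **Theorem.** Let $p$ be a prime, let $\lambda_p \ge 1$ be an odd integer and, for every prime $l$ (including $l = p$), let $\mu_l \ge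 0$ be an integer, with $\mu_l = 0$ for all but finitely many $l$. Then there exists an unramified $\mathbb{Z}_p$-covering $X_\infty/X$ of connected graphs, with $X$ a bouquet, such that $\lambda_p(X_\infty/X) = \lambda_p$ and $\mu_l(X_\infty/X) = \mu_l$ for every prime $l$. -/

import Mathlib

/-- A finite graph in Serre's formalism (multi-edges and loops allowed).  The elements of `E` are
oriented edges, and `inv` reverses the orientation of an edge. -/
structure SerreGraph where
  /-- the vertices -/
  V : Type
  /-- the oriented edges -/
  E : Type
  finite_V : Finite V
  finite_E : Finite E
  /-- the opposite edge -/
  inv : E → E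
  /-- the source of an edge -/
  s : E → V
  /-- the target of an edge -/
  t : E → V
  inv_inv : ∀ e, inv (inv e) = e
  inv_ne : ∀ e, inv e ≠ e
  s_inv : ∀ e, s (inv e) = t e
  t_inv : ∀ e, t (inv e) = s e

attribute [instance] SerreGraph.finite_V SerreGraph.finite_E

namespace SerreGraph

/-- A bouquet is a graph with exactly one vertex. -/
def IsBouquet (X : SerreGraph) : Prop := Nat.card X.V = 1

/-- `X.Reachable F u v`: there is a (possibly empty) path from `u` to `v` all of whose edges lie
in the set `F` of oriented edges. -/
def Reachable (X : SerreGraph) (F : Set X.E) : X.V → X.V → Prop :=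
  Relation.ReflTransGen (fun a b => ∃ e ∈ F, X.s e = a ∧ X.t e = b)

/-- A graph is connected if it is non-empty and any two vertices are joined by a path. -/
def Connected (X : SerreGraph) : Prop :=
  Nonempty X.V ∧ ∀ u v, X.Reachable Set.univ u v

/-- A spanning tree of a (non-empty) graph, given by its set `F` of oriented edges: `F` is stable
under reversal, any two vertices are joined by a path in `F`, and the number of unoriented edges,
which is half of the cardinality of `F`, is the number of vertices minus one. -/
def IsSpanningTree (X : SerreGraph) (F : Finset X.E) : Prop :=
  (∀ e ∈ F, X.inv e ∈ F) ∧ (∀ u v, X.Reachable (F : Set X.E) u v) ∧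
    F.card + 2 = 2 * Nat.card X.V

/-- The number `κ_X` of spanning trees of a graph. -/
noncomputable def numSpanningTrees (X : SerreGraph) : ℕ :=
  Nat.card {F : Finset X.E // X.IsSpanningTree F}

/-- A morphism of graphs. -/
@[ext] structure Hom (Y X : SerreGraph) where
  /-- the map on vertices -/
  onV : Y.V → X.V
  /-- the map on oriented edges -/
  onE : Y.E → X.E
  map_inv : ∀ e, onE (Y.inv e) = X.inv (onE e)
  map_s : ∀ e, X.s (onE e) = onV (Y.s e)
  map_t : ∀ e, X.t (onE e) = onV (Y.t e)

/-- The identity morphism. -/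
def Hom.id (X : SerreGraph) : Hom X X where
  onV := fun v => v
  onE := fun e => e
  map_inv := fun _ => rfl
  map_s := fun _ => rfl
  map_t := fun _ => rfl

/-- The composite of `f : Z → Y` followed by `g : Y → X`. -/
def Hom.comp {Z Y X : SerreGraph} (g : Hom Y X) (f : Hom Z Y) : Hom Z X where
  onV := fun v => g.onV (f.onV v)
  onE := fun e => g.onE (f.onE e)
  map_inv := fun e => by rw [f.map_inv, g.map_inv]
  map_s := fun e => by rw [g.map_s, f.map_s]
  map_t := fun e => by rw [g.map_t, f.map_t]

/-- An unramified covering: surjective on vertices, and for every vertex `v` it maps the set of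
edges with source `v` bijectively onto the set of edges with source the image of `v`. -/
def Hom.IsUnramifiedCovering {Y X : SerreGraph} (f : Hom Y X) : Prop :=
  Function.Surjective f.onV ∧
    ∀ (v : Y.V) (e : X.E), X.s e = f.onV v → ∃! e' : Y.E, Y.s e' = v ∧ f.onE e' = e

/-- The group of deck transformations of `f : Y → X`: pairs of permutations of the vertices and of
the oriented edges of `Y` that form an automorphism of the graph `Y` and commute with `f`. -/
def Hom.deckGroup {Y X : SerreGraph} (f : Hom Y X) :
    Subgroup (Equiv.Perm Y.V × Equiv.Perm Y.E) where
  carrier := {σ | (∀ e, σ.2 (Y.inv e) = Y.inv (σ.2 e)) ∧ (∀ e, Y.s (σ.2 e) = σ.1 (Y.s e)) ∧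
    (∀ e, Y.t (σ.2 e) = σ.1 (Y.t e)) ∧
    (∀ v, f.onV (σ.1 v) = f.onV v) ∧ (∀ e, f.onE (σ.2 e) = f.onE e)}
  one_mem' := ⟨fun _ => rfl, fun _ => rfl, fun _ => rfl, fun _ => rfl, fun _ => rfl⟩
  mul_mem' := by
    rintro σ τ ⟨a1, a2, a3, a4, a5⟩ ⟨b1, b2, b3, b4, b5⟩
    refine ⟨?_, ?_, ?_, ?_, ?_⟩ <;> intro x <;>
      simp [a1, a2, a3, a4, a5, b1, b2, b3, b4, b5]
  inv_mem' := by
    rintro σ ⟨a1, a2, a3, a4, a5⟩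
    refine ⟨?_, ?_, ?_, ?_, ?_⟩ <;> intro x
    · obtain ⟨y, rfl⟩ := σ.2.surjective x
      simp [← a1]
    · obtain ⟨y, rfl⟩ := σ.2.surjective x
      simp [a2]
    · obtain ⟨y, rfl⟩ := σ.2.surjective x
      simp [a3]
    · obtain ⟨y, rfl⟩ := σ.1.surjective x
      simp [a4]
    · obtain ⟨y, rfl⟩ := σ.2.surjective x
      simp [a5]

/-- `f : Y → X` is an unramified Galois covering with Galois group isomorphic to `G`: it is an
unramified covering, its deck transformations permute every fibre of vertices transitively, and
the group of deck transformations is isomorphic to `G`. -/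
def Hom.IsGaloisCovering {Y X : SerreGraph} (f : Hom Y X) (G : Type*) [Group G] : Prop :=
  f.IsUnramifiedCovering ∧
    (∀ v w : Y.V, f.onV v = f.onV w → ∃ σ ∈ f.deckGroup, σ.1 v = w) ∧
    Nonempty (f.deckGroup ≃* G)

/-- The composite morphism `X n → X 0` in a tower of graphs. -/
def towerToBase (X : ℕ → SerreGraph) (π : ∀ n, Hom (X (n + 1)) (X n)) : ∀ n, Hom (X n) (X 0)
  | 0 => Hom.id (X 0)
  | n + 1 => (towerToBase X π n).comp (π n)

end SerreGraph

/-- An unramified `ℤ_p`-covering of connected graphs: a tower `X 0 ← X 1 ← X 2 ← ⋯` of unramified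
coverings of connected graphs such that `X n → X 0` is a Galois covering with Galois group
isomorphic to `ℤ / p ^ n ℤ` for every `n`. -/
structure UnramifiedZpCovering (p : ℕ) where
  /-- the graph at level `n`; the base graph is `X 0` -/
  X : ℕ → SerreGraph
  /-- the covering maps -/
  π : ∀ n, SerreGraph.Hom (X (n + 1)) (X n)
  connected : ∀ n, (X n).Connected
  unramified : ∀ n, (π n).IsUnramifiedCovering
  galois : ∀ n,
    (SerreGraph.towerToBase X π n).IsGaloisCovering (Multiplicative (ZMod (p ^ n)))

namespace UnramifiedZpCovering

/-- The invariants `λ_p` and `μ_p` of the covering are `lam` and `mu`: for some integer `ν`,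
`ord_p (κ_{X n}) = lam * n + mu * p ^ n + ν` holds for all large `n`.
This determines `lam` and `mu` uniquely. -/
def HasInvariants {p : ℕ} (C : UnramifiedZpCovering p) (lam mu : ℕ) : Prop :=
  ∃ ν : ℤ, ∀ᶠ n : ℕ in Filter.atTop,
    (padicValNat p (C.X n).numSpanningTrees : ℤ) = lam * n + mu * (p : ℤ) ^ n + ν

/-- For a prime `l ≠ p`, the invariant `μ_l` of the covering is `mu`: for some integer `ν`,
`ord_l (κ_{X n}) = mu * p ^ n + ν` holds for all large `n`.  This determines `mu` uniquely. -/
def HasMuInvariant {p : ℕ} (C : UnramifiedZpCovering p) (l mu : ℕ) : Prop :=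
  ∃ ν : ℤ, ∀ᶠ n : ℕ in Filter.atTop,
    (padicValNat l (C.X n).numSpanningTrees : ℤ) = mu * (p : ℤ) ^ n + ν

end UnramifiedZpCovering

/-! ### Matrix-tree theorem via parent assignments -/

open Finset

/-! Take for `X n` the Cayley graph of ℤ/pⁿ for one fixed finite family of voltages containing 1, so
that `X 0` is a bouquet. The matrix-tree theorem and the characters of ℤ/pⁿ give pⁿ κ(X n) = ∏ E(z)
over the pⁿ-th roots of unity z ≠ 1, where E(z) = ∑ (2 - z^h - z^(-h)) over the voltages h.

Everything then rests on the choice of voltages. With λ = 2j - 1, the voltage j - i is used M ·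
binom(2j, i) · (p - 1)^i times for i < j, where ord_l M = μ_l for every prime l. Then z^j E(z) = M
f(z) for an integer polynomial f, and grouping roots by exact order gives pⁿ κ(X n) = M^(pⁿ - 1) ∏
|Res(Φ, f)|, with Φ running over the cyclotomic polynomials of levels p, …, pⁿ.

The factor M^(pⁿ - 1) produces all the μ_l. Since p - 1 ≡ -1, the binomial theorem gives f ≡ -(X -
1)^(2j) mod p, and at high level each resultant has p-adic valuation exactly 2j
(`padicValInt_resultant_cyclotomic`). Dividing by pⁿ leaves slope 2j - 1. For l ≠ p, f is nonzero
mod l and has finitely many roots there, so l divides only finitely many resultants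
(`eventually_not_dvd_resultant_cyclotomic`). -/

/-- The matrix of a functional digraph `g` with all edges out of `r` removed has determinant `1` when
`h` strictly decreases along `g` outside of `r`. -/
theorem det_functional_eq_one {V R : Type*} [Fintype V] [DecidableEq V] [CommRing R] {r : V}
    {g : V → V} {h : V → ℕ} (hg : ∀ v, v ≠ r → h (g v) < h v) :
    (Matrix.of fun v w : V => if v = r then (if w = r then 1 else 0) else
      (if v = w then 1 else 0) - (if g v = w then 1 else 0) : Matrix V V R).det = 1 := by
  set M : Matrix V V R := Matrix.of fun v w : V => if v = r then (if w = r then 1 else 0) else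
      (if v = w then 1 else 0) - (if g v = w then 1 else 0) with hM
  have key : ∀ v w, h v ≤ h w → M v w = if v = w then 1 else 0 := by
    intro v w hvw
    simp only [hM, Matrix.of_apply]
    by_cases hv : v = r
    · simp [hv, eq_comm]
    · have : g v ≠ w := by
        rintro rfl
        exact absurd (hg v hv) (not_lt.2 hvw)
      simp [hv, this]
  -- The blocks are the level sets of `h`; the order is dual because each row points to a smaller
  -- height. By `key` the diagonal blocks are identity matrices.
  have hT : M.BlockTriangular (fun v => OrderDual.toDual (h v)) := by
    intro i j hij
    have hij' : h i < h j := hij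
    rw [key i j hij'.le, if_neg]
    rintro rfl
    exact lt_irrefl _ hij'
  rw [hT.det]
  refine Finset.prod_eq_one fun a _ => ?_
  have : M.toSquareBlock (fun v => OrderDual.toDual (h v)) a = 1 := by
    ext ⟨i, hi⟩ ⟨j, hj⟩
    rw [Matrix.toSquareBlock_def, Matrix.of_apply, key i j, Matrix.one_apply]
    · simp [Subtype.ext_iff]
    · have hij : OrderDual.toDual (h i) = OrderDual.toDual (h j) := hi.trans hj.symm
      exact le_of_eq (OrderDual.toDual.injective hij)
  rw [this, Matrix.det_one]

/-- If no function strictly decreases along `g` outside of `r`, the matrix of the functional digraph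
has determinant `0`. -/
theorem det_functional_eq_zero {V R : Type*} [Fintype V] [DecidableEq V] [CommRing R] [IsDomain R]
    {r : V} {g : V → V} (hg : ¬ ∃ h : V → ℕ, ∀ v, v ≠ r → h (g v) < h v) :
    (Matrix.of fun v w : V => if v = r then (if w = r then 1 else 0) else
      (if v = w then 1 else 0) - (if g v = w then 1 else 0) : Matrix V V R).det = 0 := by
  classical
  have hS : ∃ v, ∀ k, g^[k] v ≠ r := by
    by_contra! hc
    refine hg ⟨fun v => Nat.find (hc v), fun v hv => ?_⟩
    have h1 := Nat.find_spec (hc v)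
    change Nat.find (hc (g v)) < Nat.find (hc v)
    rcases hk : Nat.find (hc v) with _ | k
    · rw [hk] at h1
      exact absurd h1 hv
    · rw [hk, Function.iterate_succ_apply] at h1
      exact Nat.lt_succ_of_le (Nat.find_min' (hc (g v)) h1)
  obtain ⟨v₀, hv₀⟩ := hS
  -- Kernel vector: the indicator of the vertices whose forward orbit avoids `r`.
  refine Matrix.exists_mulVec_eq_zero_iff.1 ⟨fun v => if ∀ k, g^[k] v ≠ r then 1 else 0, ?_, ?_⟩
  · intro h0
    have := congrFun h0 v₀
    simp [hv₀] at this
  · ext v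
    by_cases hv : v = r
    · subst hv
      have : ¬ ∀ k, g^[k] v ≠ v := fun h => h 0 rfl
      simp only [Matrix.mulVec, dotProduct, Matrix.of_apply, if_true, ite_mul, one_mul, zero_mul,
        Finset.sum_ite_eq', Finset.mem_univ, if_neg this, Pi.zero_apply]
    · have hiff : (∀ k, g^[k] v ≠ r) ↔ ∀ k, g^[k] (g v) ≠ r := by
        constructor
        · intro h k
          exact h (k + 1)
        · intro h k
          rcases k with _ | k
          · exact hv
          · exact h k
      simp only [Matrix.mulVec, dotProduct, Matrix.of_apply, if_neg hv, sub_mul, ite_mul, one_mul,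
        zero_mul, Finset.sum_sub_distrib, Finset.sum_ite_eq, Finset.mem_univ, if_true,
        Pi.zero_apply]
      by_cases h1 : ∀ k, g^[k] v ≠ r
      · rw [if_pos h1, if_pos (hiff.1 h1), sub_self]
      · rw [if_neg h1, if_neg (fun h => h1 (hiff.2 h)), sub_self]

namespace SerreGraph

variable (X : SerreGraph)

/-- Reachability along a reversal-stable set of edges is symmetric. -/
theorem Reachable.symm {X : SerreGraph} {F : Set X.E} (hF : ∀ e ∈ F, X.inv e ∈ F) {u v : X.V}
    (h : X.Reachable F u v) : X.Reachable F v u := by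
  induction h with
  | refl => exact Relation.ReflTransGen.refl
  | tail _ hbc ih =>
    obtain ⟨e, he, rfl, rfl⟩ := hbc
    exact Relation.ReflTransGen.head ⟨X.inv e, hF e he, X.s_inv e, X.t_inv e⟩ ih

/-- A parent assignment with root `r`: every vertex but `r` chooses an edge leaving it. -/
def IsParentAssignment (r : X.V) (φ : X.V → Option X.E) : Prop :=
  φ r = none ∧ ∀ v, v ≠ r → ∃ e, φ v = some e ∧ X.s e = v

/-- The parent of a vertex. -/
def parent (φ : X.V → Option X.E) (v : X.V) : X.V := (φ v).elim v X.t

/-- A parent assignment is acyclic if some height function decreases towards the root. -/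
def IsAcyclicAssignment (r : X.V) (φ : X.V → Option X.E) : Prop :=
  ∃ h : X.V → ℕ, ∀ v, v ≠ r → h (X.parent φ v) < h v

/-- The edges chosen by a parent assignment, in both orientations. -/
noncomputable def assignmentEdges [Fintype X.E] (φ : X.V → Option X.E) : Finset X.E :=
  open Classical in univ.filter fun e => φ (X.s e) = some e ∨ φ (X.t e) = some (X.inv e)

theorem mem_assignmentEdges [Fintype X.E] {φ : X.V → Option X.E} {e : X.E} :
    e ∈ X.assignmentEdges φ ↔ φ (X.s e) = some e ∨ φ (X.t e) = some (X.inv e) := by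
  classical
  simp [assignmentEdges]

variable {X}

theorem IsAcyclicAssignment.two_cycle {r : X.V} {φ : X.V → Option X.E}
    (hφ : X.IsParentAssignment r φ) {h : X.V → ℕ} (hh : ∀ v, v ≠ r → h (X.parent φ v) < h v)
    {e : X.E} (h1 : φ (X.s e) = some e) (h2 : φ (X.t e) = some (X.inv e)) : False := by
  have hne : ∀ {v : X.V} {e : X.E}, φ v = some e → v ≠ r := by
    rintro v e hv rfl
    rw [hφ.1] at hv
    cases hv
  have a := hh _ (hne h1)
  have b := hh _ (hne h2)
  simp only [parent, h1, h2, Option.elim, X.t_inv] at a b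
  exact lt_asymm a b

theorem isSpanningTree_assignmentEdges [Fintype X.E] {r : X.V} {φ : X.V → Option X.E}
    (hφ : X.IsParentAssignment r φ) (ha : X.IsAcyclicAssignment r φ) :
    X.IsSpanningTree (X.assignmentEdges φ) := by
  classical
  have := Fintype.ofFinite X.V
  obtain ⟨h, hh⟩ := ha
  have hinv : ∀ e ∈ X.assignmentEdges φ, X.inv e ∈ X.assignmentEdges φ := by
    intro e he
    rw [mem_assignmentEdges] at he ⊢
    rw [X.s_inv, X.t_inv, X.inv_inv]
    exact he.symm
  refine ⟨hinv, ?_, ?_⟩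
  · have hr : ∀ n v, h v = n → X.Reachable (X.assignmentEdges φ : Set X.E) v r := by
      intro n
      induction n using Nat.strong_induction_on with
      | _ n ih =>
        intro v hv
        by_cases hvr : v = r
        · rw [hvr]
          exact Relation.ReflTransGen.refl
        · obtain ⟨e, he, hs⟩ := hφ.2 v hvr
          have hlt := hh v hvr
          simp only [parent, he, Option.elim] at hlt
          refine Relation.ReflTransGen.head ⟨e, ?_, hs, rfl⟩ (ih _ (hv ▸ hlt) _ rfl)
          rw [Finset.mem_coe, mem_assignmentEdges]
          left
          rw [hs, he]
    intro u v
    exact (hr _ u rfl).trans ((hr _ v rfl).symm hinv)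
  · set D : Finset X.E := univ.filter fun e => φ (X.s e) = some e with hD
    have hU : X.assignmentEdges φ = D ∪ D.image X.inv := by
      ext e
      simp only [mem_assignmentEdges, hD, mem_union, mem_filter, mem_univ, true_and, mem_image]
      refine or_congr Iff.rfl ⟨fun h => ⟨X.inv e, by rwa [X.s_inv], X.inv_inv e⟩, ?_⟩
      rintro ⟨e', he', rfl⟩
      rwa [X.t_inv, X.inv_inv]
    have hdisj : Disjoint D (D.image X.inv) := by
      rw [Finset.disjoint_left]
      intro e he he'
      obtain ⟨e', he₁, rfl⟩ := mem_image.1 he'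
      simp only [hD, mem_filter, mem_univ, true_and] at he he₁
      refine IsAcyclicAssignment.two_cycle hφ hh he₁ ?_
      rwa [X.s_inv] at he
    have hDcard : D.card = Fintype.card X.V - 1 := by
      have : D.image X.s = univ.erase r := by
        ext v
        simp only [hD, mem_image, mem_filter, mem_univ, true_and, mem_erase, and_true]
        constructor
        · rintro ⟨e, he, rfl⟩ h
          rw [h, hφ.1] at he
          cases he
        · intro hv
          obtain ⟨e, he, hs⟩ := hφ.2 v hv
          exact ⟨e, by rw [hs, he], hs⟩
      rw [← card_univ, ← card_erase_of_mem (mem_univ r), ← this, card_image_of_injOn]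
      intro e he e' he' hs
      simp only [hD, coe_filter, mem_univ, true_and, Set.mem_ofPred_eq] at he he'
      have hs' : X.s e = X.s e' := hs
      rw [hs', he'] at he
      exact (Option.some.inj he).symm
    have hinj : Function.Injective X.inv := fun a b hab => by
      rw [← X.inv_inv a, hab, X.inv_inv]
    have hpos : 0 < Fintype.card X.V := Fintype.card_pos_iff.2 ⟨r⟩
    rw [hU, card_union_of_disjoint hdisj, card_image_of_injective _ hinj, hDcard,
      Nat.card_eq_fintype_card]
    omega

/-- Induction on the height for `ψ`: if `φ` does not choose the edge that `ψ` chooses at `v`, it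
chooses the reverse edge at the parent. There both agree by induction, so `ψ` would contain a
two-cycle. -/
theorem assignmentEdges_injective [Fintype X.E] {r : X.V} {φ ψ : X.V → Option X.E}
    (hφ : X.IsParentAssignment r φ) (hψ : X.IsParentAssignment r ψ)
    (ha : X.IsAcyclicAssignment r ψ)
    (heq : X.assignmentEdges φ = X.assignmentEdges ψ) : φ = ψ := by
  obtain ⟨h, hh⟩ := ha
  have key : ∀ n v, h v = n → φ v = ψ v := by
    intro n
    induction n using Nat.strong_induction_on with
    | _ n ih =>
      intro v hv
      by_cases hvr : v = r
      · rw [hvr, hφ.1, hψ.1]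
      · obtain ⟨e, he, rfl⟩ := hψ.2 v hvr
        have hmem : e ∈ X.assignmentEdges φ := by
          rw [heq, mem_assignmentEdges]
          exact Or.inl he
        rcases X.mem_assignmentEdges.1 hmem with h1 | h1
        · rw [h1, he]
        · have hlt := hh _ hvr
          simp only [parent, he, Option.elim] at hlt
          rw [ih _ (hv ▸ hlt) _ rfl] at h1
          exact (IsAcyclicAssignment.two_cycle hψ hh he h1).elim
  funext v
  exact key _ v rfl

theorem IsSpanningTree.exists_assignment [Fintype X.E] (r : X.V) {F : Finset X.E}
    (hF : X.IsSpanningTree F) :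
    ∃ φ, X.IsParentAssignment r φ ∧ X.IsAcyclicAssignment r φ ∧ X.assignmentEdges φ = F := by
  classical
  -- `P k v` means that a walk of `k` edges in `F` leads from `v` to `r`. The parent edge starts a
  -- shortest such walk, whose length serves as height.
  let P : ℕ → X.V → Prop := fun k => Nat.rec (motive := fun _ => X.V → Prop) (fun v => v = r)
    (fun _ Q v => ∃ e ∈ F, X.s e = v ∧ Q (X.t e)) k
  have hP : ∀ v, ∃ k, P k v := by
    intro v
    refine Relation.ReflTransGen.head_induction_on (hF.2.1 v r) ⟨0, rfl⟩ ?_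
    rintro a c ⟨e, he, rfl, rfl⟩ - ⟨k, hk⟩
    exact ⟨k + 1, e, he, rfl, hk⟩
  have hstep : ∀ v, v ≠ r → ∃ e ∈ F, X.s e = v ∧ Nat.find (hP (X.t e)) < Nat.find (hP v) := by
    intro v hv
    have h1 := Nat.find_spec (hP v)
    rcases hk : Nat.find (hP v) with _ | k
    · rw [hk] at h1
      exact absurd h1 hv
    · rw [hk] at h1
      obtain ⟨e, he, hs, hQ⟩ := h1
      exact ⟨e, he, hs, Nat.lt_succ_of_le (Nat.find_min' _ hQ)⟩
  choose p hpF hps hpt using hstep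
  let φ : X.V → Option X.E := fun v => if hv : v = r then none else some (p v hv)
  have hφ : X.IsParentAssignment r φ := by
    refine ⟨dif_pos rfl, fun v hv => ⟨p v hv, dif_neg hv, hps v hv⟩⟩
  have ha : X.IsAcyclicAssignment r φ := by
    refine ⟨fun v => Nat.find (hP v), fun v hv => ?_⟩
    have : X.parent φ v = X.t (p v hv) := by simp [parent, φ, hv]
    rw [this]
    exact hpt v hv
  have hmem : ∀ {v e}, φ v = some e → e ∈ F := by
    intro v e he
    by_cases hv : v = r
    · simp [φ, hv] at he
    · simp only [φ, dif_neg hv, Option.some.injEq] at he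
      exact he ▸ hpF v hv
  refine ⟨φ, hφ, ha, Finset.eq_of_subset_of_card_le ?_ ?_⟩
  · intro e he
    rcases X.mem_assignmentEdges.1 he with h | h
    · exact hmem h
    · have := hF.1 _ (hmem h)
      rwa [X.inv_inv] at this
  · have h1 := (isSpanningTree_assignmentEdges hφ ha).2.2
    have h2 := hF.2.2
    omega

variable (X)

theorem numSpanningTrees_eq_card_assignments [Fintype X.E] (r : X.V) :
    X.numSpanningTrees =
      Nat.card {φ // X.IsParentAssignment r φ ∧ X.IsAcyclicAssignment r φ} := by
  symm
  refine Nat.card_eq_of_bijective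
    (fun φ => ⟨X.assignmentEdges φ.1, isSpanningTree_assignmentEdges φ.2.1 φ.2.2⟩) ⟨?_, ?_⟩
  · intro ⟨φ, h1, _⟩ ⟨ψ, h2, h3⟩ h
    exact Subtype.ext (assignmentEdges_injective h1 h2 h3 (congrArg Subtype.val h))
  · rintro ⟨F, hF⟩
    obtain ⟨φ, h1, h2, h3⟩ := hF.exists_assignment r
    exact ⟨⟨φ, h1, h2⟩, Subtype.ext h3⟩

/-- The Laplacian matrix of a graph. -/
def laplacian (R : Type*) [CommRing R] [Fintype X.E] [DecidableEq X.V] : Matrix X.V X.V R :=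
  Matrix.of fun v w => ∑ e with X.s e = v,
    ((if v = w then 1 else 0) - (if X.t e = w then 1 else 0))

/-- **Matrix-tree theorem**, with the row of the root replaced by a unit vector. -/
theorem det_updateRow_laplacian (R : Type*) [CommRing R] [IsDomain R] [Fintype X.E] [Fintype X.V]
    [DecidableEq X.V] (r : X.V) :
    ((X.laplacian R).updateRow r (Pi.single r 1)).det = X.numSpanningTrees := by
  classical
  -- Each row is a sum over the choices available at its vertex, `none` standing for the unit row at
  -- `r`. Expanding the determinant multilinearly then sums over exactly the parent assignments.
  let A : X.V → Finset (Option X.E) := fun v =>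
    if v = r then {none} else (univ.filter fun e => X.s e = v).image some
  let c : X.V → Option X.E → X.V → R := fun v o => o.elim (Pi.single r 1)
    fun e w => (if v = w then 1 else 0) - (if X.t e = w then 1 else 0)
  have hrow : (X.laplacian R).updateRow r (Pi.single r 1) = fun v => ∑ o ∈ A v, c v o := by
    funext v
    by_cases hv : v = r
    · subst hv
      simp [A, c]
    · rw [Matrix.updateRow_ne hv]
      funext w
      simp only [A, if_neg hv]
      rw [sum_image (fun _ _ _ _ h => Option.some.inj h), Finset.sum_apply]
      simp [c, laplacian]
  have hA : ∀ φ, φ ∈ Fintype.piFinset A ↔ X.IsParentAssignment r φ := by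
    intro φ
    rw [Fintype.mem_piFinset]
    constructor
    · intro h
      refine ⟨by simpa [A] using h r, fun v hv => ?_⟩
      have := h v
      simp only [A, if_neg hv, mem_image, mem_filter, mem_univ, true_and] at this
      obtain ⟨e, he, hφ⟩ := this
      exact ⟨e, hφ.symm, he⟩
    · rintro ⟨h1, h2⟩ v
      by_cases hv : v = r
      · subst hv
        simp [A, h1]
      · obtain ⟨e, he, hs⟩ := h2 v hv
        simp only [A, if_neg hv, mem_image, mem_filter, mem_univ, true_and]
        exact ⟨e, hs, he.symm⟩
  have hdet : ∀ φ, X.IsParentAssignment r φ →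
      (Matrix.detRowAlternating fun v => c v (φ v)) =
        if X.IsAcyclicAssignment r φ then (1 : R) else 0 := by
    intro φ hφ
    have hM : (fun v => c v (φ v)) = (Matrix.of fun v w : X.V =>
        if v = r then (if w = r then 1 else 0) else
        (if v = w then 1 else 0) - (if X.parent φ v = w then 1 else 0) : Matrix X.V X.V R) := by
      funext v w
      by_cases hv : v = r
      · subst hv
        simp [hφ.1, c, Pi.single_apply]
      · obtain ⟨e, he, hs⟩ := hφ.2 v hv
        simp [he, c, hv, parent]
    rw [hM]
    split_ifs with ha
    · obtain ⟨h, hh⟩ := ha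
      exact det_functional_eq_one hh
    · exact det_functional_eq_zero ha
  have hexp := (Matrix.detRowAlternating (R := R) (n := X.V)).toMultilinearMap.map_sum_finset
    (fun v o => c v o) A
  change Matrix.detRowAlternating _ = _
  rw [hrow]
  refine hexp.trans ?_
  change ∑ φ ∈ Fintype.piFinset A, Matrix.detRowAlternating (fun v => c v (φ v)) = _
  rw [Finset.sum_congr rfl fun φ hφ => hdet φ ((hA φ).1 hφ), Finset.sum_boole,
    numSpanningTrees_eq_card_assignments X r, Nat.card_eq_fintype_card, Fintype.card_subtype]
  congr 2
  ext φ
  simp only [mem_filter, hA, mem_univ, true_and]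

theorem laplacian_mulVec_one (R : Type*) [CommRing R] [Fintype X.E] [Fintype X.V]
    [DecidableEq X.V] : (X.laplacian R).mulVec 1 = 0 := by
  funext v
  simp only [Matrix.mulVec, dotProduct, laplacian, Matrix.of_apply, Pi.one_apply, mul_one,
    Pi.zero_apply]
  rw [Finset.sum_comm]
  simp

/-- Edge reversal exchanges sources and targets, so every vertex has equal in- and out-degree. -/
theorem one_vecMul_laplacian (R : Type*) [CommRing R] [Fintype X.E] [Fintype X.V]
    [DecidableEq X.V] : Matrix.vecMul 1 (X.laplacian R) = 0 := by
  classical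
  funext w
  simp only [Matrix.vecMul, dotProduct, laplacian, Matrix.of_apply, Pi.one_apply, one_mul,
    Pi.zero_apply]
  have h1 : ∀ v, (∑ e with X.s e = v, ((if v = w then (1 : R) else 0) -
      (if X.t e = w then 1 else 0))) =
      ∑ e, if X.s e = v then ((if X.s e = w then (1 : R) else 0) -
        (if X.t e = w then 1 else 0)) else 0 := by
    intro v
    rw [Finset.sum_filter]
    refine Finset.sum_congr rfl fun e _ => ?_
    by_cases h : X.s e = v
    · simp [h]
    · simp [h]
  rw [Finset.sum_congr rfl fun v _ => h1 v, Finset.sum_comm]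
  simp only [Finset.sum_ite_eq, mem_univ, if_true, Finset.sum_sub_distrib]
  rw [sub_eq_zero]
  have hinv : Function.Involutive X.inv := X.inv_inv
  rw [← Equiv.sum_comp (hinv.toPerm X.inv) fun e => if X.t e = w then (1 : R) else 0]
  simp [X.t_inv]

/-- **Matrix-tree theorem**, for the Laplacian perturbed by the all-ones matrix. -/
theorem det_laplacian_add_ones (R : Type*) [CommRing R] [IsDomain R] [Fintype X.E] [Fintype X.V]
    [DecidableEq X.V] [Nonempty X.V] :
    (X.laplacian R + Matrix.vecMulVec 1 1).det =
      (Fintype.card X.V : R) ^ 2 * X.numSpanningTrees := by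
  obtain ⟨r⟩ := ‹Nonempty X.V›
  set L := X.laplacian R with hL
  set δ : X.V → R := Pi.single r 1 with hδ
  have hL1 : L.mulVec 1 = 0 := X.laplacian_mulVec_one R
  have h1L : Matrix.vecMul 1 L = 0 := X.one_vecMul_laplacian R
  have h11 : (1 : X.V → R) ⬝ᵥ δ = 1 := by simp [hδ]
  have h11' : δ ⬝ᵥ (1 : X.V → R) = 1 := by simp [hδ]
  -- As `L` kills the all-ones vector on both sides, the outer factors only turn δδᵀ into the
  -- all-ones matrix. Each has determinant |V|.
  have hA : L + Matrix.vecMulVec 1 1 =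
      (1 + Matrix.vecMulVec (1 - δ) 1) * (L + Matrix.vecMulVec δ δ) *
        (1 + Matrix.vecMulVec 1 (1 - δ)) := by
    have e1 : (L + Matrix.vecMulVec δ δ) * (1 + Matrix.vecMulVec 1 (1 - δ)) =
        L + Matrix.vecMulVec δ 1 := by
      rw [mul_add, mul_one, add_mul L, Matrix.mul_vecMulVec, hL1, Matrix.zero_vecMulVec, zero_add, Matrix.vecMulVec_mul_vecMulVec,
        h11', one_smul, Matrix.vecMulVec_sub]
      abel
    rw [mul_assoc, e1, add_mul, one_mul, Matrix.vecMulVec_mul, Matrix.vecMul_add, h1L,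
      Matrix.vecMul_vecMulVec, h11]
    rw [zero_add, one_smul, Matrix.sub_vecMulVec]
    abel
  have hd : ∀ u v : X.V → R, (1 + Matrix.vecMulVec u v).det = 1 + v ⬝ᵥ u := by
    intro u v
    rw [Matrix.vecMulVec_eq Unit, Matrix.det_one_add_replicateCol_mul_replicateRow]
  have hc : (1 : X.V → R) ⬝ᵥ (1 - δ) = Fintype.card X.V - 1 := by
    rw [dotProduct_sub, h11]
    simp
  have hdetL : L.det = 0 := by
    refine Matrix.exists_mulVec_eq_zero_iff.1 ⟨1, ?_, hL1⟩
    intro h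
    exact one_ne_zero (congrFun h r)
  have hupd : L + Matrix.vecMulVec δ δ = L.updateRow r (L r + δ) := by
    ext v w
    by_cases hv : v = r
    · subst hv
      simp [hδ, Matrix.vecMulVec_apply]
    · simp [hδ, Matrix.vecMulVec_apply, hv]
  rw [hA, Matrix.det_mul, Matrix.det_mul, hd, hd, dotProduct_comm (1 - δ), hc, hupd,
    Matrix.det_updateRow_add, Matrix.updateRow_eq_self, hdetL, hL, hδ,
    X.det_updateRow_laplacian R r]
  ring

end SerreGraph

/-! ### Spectrum and tree count of cyclic Cayley graphs -/

namespace SerreGraph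

/-- The displacement along a Cayley edge, for a generator or its inverse. -/
def displacement (N : ℕ) {I : Type} (h : I → ℕ) (x : I × Bool) : ZMod N :=
  if x.2 then (h x.1 : ZMod N) else -(h x.1 : ZMod N)

/-- The Cayley graph of `ZMod N` for a finite family of natural numbers. -/
def cayley (N : ℕ) [NeZero N] (I : Type) [Finite I] (h : I → ℕ) : SerreGraph where
  V := ZMod N
  E := ZMod N × I × Bool
  finite_V := inferInstance
  finite_E := inferInstance
  inv := fun e => (e.1 + displacement N h e.2, e.2.1, !e.2.2)
  s := fun e => e.1
  t := fun e => e.1 + displacement N h e.2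
  inv_inv := by
    rintro ⟨v, i, b⟩
    cases b <;> simp [displacement]
  inv_ne := by
    rintro ⟨v, i, b⟩ h
    cases b <;> simp [Prod.ext_iff] at h
  s_inv := fun _ => rfl
  t_inv := by
    rintro ⟨v, i, b⟩
    cases b <;> simp [displacement]

section Spectrum

variable {N : ℕ} [NeZero N] {I : Type} [Fintype I] (h : I → ℕ)

instance : Fintype (cayley N I h).V := inferInstanceAs (Fintype (ZMod N))
instance : DecidableEq (cayley N I h).V := inferInstanceAs (DecidableEq (ZMod N))
instance : Fintype (cayley N I h).E := inferInstanceAs (Fintype (ZMod N × I × Bool))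
instance : Nonempty (cayley N I h).V := inferInstanceAs (Nonempty (ZMod N))

theorem cayley_laplacian_apply (R : Type*) [CommRing R] (v w : ZMod N) :
    (cayley N I h).laplacian R v w = ∑ x : I × Bool,
      ((if v = w then (1 : R) else 0) - (if v + displacement N h x = w then 1 else 0)) := by
  classical
  change ∑ e : ZMod N × I × Bool with e.1 = v,
    ((if v = w then (1 : R) else 0) - (if e.1 + displacement N h e.2 = w then 1 else 0)) = _
  rw [Finset.sum_filter, Fintype.sum_prod_type, Finset.sum_eq_single v]
  · simp
  · intro u _ hu
    simp [hu]
  · simp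

/-- The eigenvalue of the Laplacian of a Cayley graph of a cyclic group at the character sending the
generator to `z`. -/
def cayleyEigenvalue {K : Type*} [Field K] (z : K) : K :=
  ∑ i, (2 - z ^ h i - z⁻¹ ^ h i)

theorem cayley_laplacian_character (ψ : AddChar (ZMod N) ℂ) (v : ZMod N) :
    ∑ w : ZMod N, (cayley N I h).laplacian ℂ v w * ψ w = ψ v * cayleyEigenvalue h (ψ 1) := by
  simp only [cayley_laplacian_apply, Finset.sum_mul]
  rw [Finset.sum_comm, Fintype.sum_prod_type, cayleyEigenvalue, Finset.mul_sum]
  refine Finset.sum_congr rfl fun i _ => ?_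
  have h1 : ψ (h i : ZMod N) = ψ 1 ^ h i := by
    rw [← AddChar.map_nsmul_eq_pow, nsmul_one]
  have h2 : ψ (-(h i : ZMod N)) = (ψ 1)⁻¹ ^ h i := by
    rw [AddChar.map_neg_eq_inv, h1, inv_pow]
  simp only [Fintype.sum_bool, displacement, sub_mul, ite_mul, one_mul, zero_mul,
    Finset.sum_sub_distrib, Finset.sum_ite_eq, mem_univ, if_true, AddChar.map_add_eq_mul, h1, h2,
    Bool.false_eq_true, if_false]
  ring

/-- Unlike a minor of the Laplacian, this perturbation is still diagonal in the basis of characters: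
the all-ones matrix acts as `N` on the trivial character and as 0 on the others. -/
theorem det_cayley_laplacian_add_ones :
    ((cayley N I h).laplacian ℂ + Matrix.vecMulVec 1 1).det =
      ∏ k : ZMod N, (cayleyEigenvalue h (ZMod.stdAddChar k) + if k = 0 then (N : ℂ) else 0) := by
  set ψ : AddChar (ZMod N) ℂ := ZMod.stdAddChar with hψ
  have hprim : ψ.IsPrimitive := ZMod.isPrimitive_stdAddChar N
  set F : Matrix (ZMod N) (ZMod N) ℂ := Matrix.of fun v k => ψ (v * k) with hF
  set F' : Matrix (ZMod N) (ZMod N) ℂ := Matrix.of fun k w => ψ (-(w * k)) with hF'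
  set M : Matrix (ZMod N) (ZMod N) ℂ :=
    (cayley N I h).laplacian ℂ + Matrix.vecMulVec 1 1 with hM
  have hFF : F * F' = (N : ℂ) • 1 := by
    ext v w
    have : ∀ k, ψ (v * k) * ψ (-(w * k)) = ψ (k * (v - w)) := by
      intro k
      rw [← AddChar.map_add_eq_mul]
      congr 1
      ring
    simp only [Matrix.mul_apply, hF, hF', Matrix.of_apply, this]
    rw [AddChar.sum_mulShift _ hprim, ZMod.card]
    by_cases hvw : v = w
    · simp [hvw]
    · simp [hvw, sub_eq_zero]
  have hN : (N : ℂ) ≠ 0 := Nat.cast_ne_zero.2 (NeZero.ne N)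
  have hdetF : F.det ≠ 0 := by
    intro h0
    have := congrArg Matrix.det hFF
    rw [Matrix.det_mul, h0, zero_mul, Matrix.det_smul, Matrix.det_one, mul_one] at this
    exact pow_ne_zero _ hN this.symm
  have hMF : M * F = F * Matrix.diagonal fun k =>
      cayleyEigenvalue h (ψ k) + if k = 0 then (N : ℂ) else 0 := by
    ext v k
    rw [Matrix.mul_diagonal, Matrix.mul_apply]
    have h1 : ∀ w, M v w = (cayley N I h).laplacian ℂ v w + 1 := by
      intro w
      exact congrArg ((cayley N I h).laplacian ℂ v w + ·) (one_mul (1 : ℂ))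
    simp only [h1, add_mul, one_mul, Finset.sum_add_distrib, mul_add]
    congr 1
    · have := cayley_laplacian_character h (ψ.mulShift k) v
      simp only [AddChar.mulShift_apply, mul_one] at this
      simpa only [hF, Matrix.of_apply, mul_comm _ k] using this
    · simp only [hF, Matrix.of_apply]
      rw [AddChar.sum_mulShift _ hprim, ZMod.card]
      by_cases hk : k = 0
      · simp [hk]
      · simp [hk]
  have := congrArg Matrix.det hMF
  rw [Matrix.det_mul, Matrix.det_mul, Matrix.det_diagonal, mul_comm] at this
  exact mul_left_cancel₀ hdetF this

theorem prod_stdAddChar_ne_zero (f : ℂ → ℂ) :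
    ∏ k ∈ univ.erase (0 : ZMod N), f (ZMod.stdAddChar k) =
      ∏ z ∈ (Polynomial.nthRootsFinset N (1 : ℂ)).erase 1, f z := by
  classical
  have hinj : Function.Injective (ZMod.stdAddChar (N := N)) := ZMod.injective_stdAddChar
  have himg : (univ : Finset (ZMod N)).image (ZMod.stdAddChar (N := N)) =
      Polynomial.nthRootsFinset N (1 : ℂ) := by
    refine Finset.eq_of_subset_of_card_le ?_ ?_
    · intro z hz
      obtain ⟨k, -, rfl⟩ := mem_image.1 hz
      rw [Polynomial.mem_nthRootsFinset (NeZero.pos N), ← AddChar.map_nsmul_eq_pow]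
      simp
    · rw [card_image_of_injective _ hinj, card_univ, ZMod.card,
        (Complex.isPrimitiveRoot_exp N (NeZero.ne N)).card_nthRootsFinset]
  have h1 : (Polynomial.nthRootsFinset N (1 : ℂ)).erase 1 =
      ((univ : Finset (ZMod N)).erase 0).image (ZMod.stdAddChar (N := N)) := by
    rw [Finset.image_erase hinj, himg, AddChar.map_zero_eq_one]
  rw [h1, Finset.prod_image (hinj.injOn)]

/-- The number of spanning trees of a Cayley graph of a cyclic group is the product of the nonzero
Laplace eigenvalues divided by the order of the group. -/
theorem card_mul_numSpanningTrees_cayley :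
    (N : ℂ) * (cayley N I h).numSpanningTrees =
      ∏ z ∈ (Polynomial.nthRootsFinset N (1 : ℂ)).erase 1, cayleyEigenvalue h z := by
  have h1 := (cayley N I h).det_laplacian_add_ones ℂ
  have hcard : Fintype.card (cayley N I h).V = N := ZMod.card N
  rw [det_cayley_laplacian_add_ones, hcard, ← Finset.mul_prod_erase _ _ (mem_univ (0 : ZMod N))] at h1
  have h2 : cayleyEigenvalue h (ZMod.stdAddChar (0 : ZMod N)) = 0 := by
    rw [AddChar.map_zero_eq_one]
    simp only [cayleyEigenvalue, one_pow, inv_one]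
    exact Finset.sum_eq_zero fun _ _ => by norm_num
  have h3 : ∀ k ∈ univ.erase (0 : ZMod N), (cayleyEigenvalue h (ZMod.stdAddChar k) +
      if k = 0 then (N : ℂ) else 0) = cayleyEigenvalue h (ZMod.stdAddChar k) := by
    intro k hk
    rw [if_neg (ne_of_mem_erase hk), add_zero]
  rw [h2, if_pos rfl, zero_add, Finset.prod_congr rfl h3, prod_stdAddChar_ne_zero, sq,
    mul_assoc] at h1
  exact (mul_left_cancel₀ (Nat.cast_ne_zero.2 (NeZero.ne N)) h1).symm

end Spectrum

end SerreGraph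

/-! ### The tower and its Galois groups -/

namespace SerreGraph

section Tower

variable {I : Type} (h : I → ℕ)

theorem displacement_castHom {M N : ℕ} (hMN : M ∣ N) (x : I × Bool) :
    ZMod.castHom hMN (ZMod M) (displacement N h x) = displacement M h x := by
  unfold displacement
  split_ifs
  · exact map_natCast _ _
  · rw [map_neg, map_natCast]

variable [Finite I]

theorem cayley_connected {N : ℕ} [NeZero N] {i : I} (hi : h i = 1) : (cayley N I h).Connected := by
  have hstep : ∀ (u : ZMod N) (k : ℕ), (cayley N I h).Reachable Set.univ u (u + k : ZMod N) := by
    intro u k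
    induction k with
    | zero =>
      rw [Nat.cast_zero, add_zero]
      exact Relation.ReflTransGen.refl
    | succ k ih =>
      refine Relation.ReflTransGen.tail ih ⟨((u + k : ZMod N), i, true), trivial, rfl, ?_⟩
      simp [cayley, displacement, hi, add_assoc]
  have hreach : ∀ u v : ZMod N, (cayley N I h).Reachable Set.univ u v := by
    intro u v
    have := hstep u (v - u).val
    rwa [ZMod.natCast_zmod_val, add_sub_cancel] at this
  exact ⟨⟨(0 : ZMod N)⟩, hreach⟩

/-- The reduction map between Cayley graphs of cyclic groups. -/
def cayleyReduction {M N : ℕ} [NeZero M] [NeZero N] (hMN : M ∣ N) :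
    Hom (cayley N I h) (cayley M I h) where
  onV := fun v => ZMod.castHom hMN (ZMod M) v
  onE := fun e => (ZMod.castHom hMN (ZMod M) e.1, e.2)
  map_inv := by
    rintro ⟨v, x⟩
    change (ZMod.castHom hMN (ZMod M) (v + displacement N h x), x.1, !x.2) = _
    rw [map_add, displacement_castHom]
    rfl
  map_s := fun _ => rfl
  map_t := by
    rintro ⟨v, x⟩
    change _ = ZMod.castHom hMN (ZMod M) (v + displacement N h x)
    rw [map_add, displacement_castHom]
    rfl

theorem cayleyReduction_isUnramifiedCovering {M N : ℕ} [NeZero M] [NeZero N] (hMN : M ∣ N) :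
    (cayleyReduction h hMN).IsUnramifiedCovering := by
  refine ⟨ZMod.castHom_surjective hMN, ?_⟩
  intro v e he
  refine ⟨(v, e.2), ⟨rfl, Prod.ext he.symm rfl⟩, ?_⟩
  rintro ⟨v', x⟩ ⟨hv, hx⟩
  refine Prod.ext hv ?_
  rw [← hx]
  rfl

/-- Any morphism from the Cayley graph of `ZMod N` to a bouquet that keeps the labels of the edges is
a Galois covering with group `ZMod N`, provided that one of the generators is `1`. -/
theorem isGaloisCovering_of_labels {M N : ℕ} [NeZero M] [NeZero N] [Subsingleton (ZMod M)] {i : I}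
    (hi : h i = 1) (f : Hom (cayley N I h) (cayley M I h)) (hf : ∀ e, (f.onE e).2 = e.2) :
    f.IsGaloisCovering (Multiplicative (ZMod N)) := by
  have hsub : ∀ x y : (cayley M I h).V, x = y := fun x y => Subsingleton.elim (α := ZMod M) x y
  have hE : ∀ x y : (cayley M I h).E, x.2 = y.2 → x = y := fun x y hxy => Prod.ext (hsub _ _) hxy
  let τ : ZMod N → Equiv.Perm (cayley N I h).V × Equiv.Perm (cayley N I h).E := fun a =>
    ((Equiv.addLeft a : Equiv.Perm (ZMod N)),
      ((Equiv.addLeft a : Equiv.Perm (ZMod N)).prodCongr (Equiv.refl (I × Bool))))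
  have hτ : ∀ a, τ a ∈ f.deckGroup := by
    intro a
    refine ⟨?_, fun _ => rfl, ?_, fun _ => hsub _ _, fun e => hE _ _ ?_⟩
    · rintro ⟨v, x⟩
      exact Prod.ext (add_assoc a v (displacement N h x)).symm rfl
    · rintro ⟨v, x⟩
      exact add_assoc a v (displacement N h x)
    · rw [hf, hf]
      rfl
  refine ⟨⟨fun y => ⟨(0 : ZMod N), hsub _ _⟩, ?_⟩, ?_, ?_⟩
  · intro v e _
    refine ⟨(v, e.2), ⟨rfl, hE _ _ (hf _)⟩, ?_⟩
    rintro ⟨v', x⟩ ⟨hv, hx⟩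
    refine Prod.ext hv ?_
    rw [← hf (v', x), hx]
  · have htrans : ∀ v w : ZMod N, ∃ σ ∈ f.deckGroup, σ.1 v = w := fun v w =>
      ⟨τ (w - v), hτ _, sub_add_cancel w v⟩
    exact fun v w _ => htrans v w
  · let Φ : Multiplicative (ZMod N) →* f.deckGroup :=
      { toFun := fun a => ⟨τ a.toAdd, hτ _⟩
        map_one' := by
          refine Subtype.ext (Prod.ext (Equiv.ext fun v => zero_add (show ZMod N from v))
            (Equiv.ext fun e => Prod.ext (zero_add (show ZMod N from e.1)) rfl))
        map_mul' := fun a b => by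
          refine Subtype.ext (Prod.ext (Equiv.ext fun v => add_assoc a.toAdd b.toAdd _)
            (Equiv.ext fun e => Prod.ext (add_assoc a.toAdd b.toAdd _) rfl)) }
    refine ⟨(MulEquiv.ofBijective Φ ⟨?_, ?_⟩).symm⟩
    · intro a b hab
      have h1 : (a.toAdd + 0 : ZMod N) = b.toAdd + 0 :=
        congrArg (fun σ : f.deckGroup => (σ.1.1 (0 : ZMod N) : ZMod N)) hab
      simpa using h1
    · rintro ⟨⟨σ, ρ⟩, h1, h2, h3, -, h5⟩
      change ∀ e, (cayley N I h).s (ρ e) = σ ((cayley N I h).s e) at h2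
      change ∀ e, (cayley N I h).t (ρ e) = σ ((cayley N I h).t e) at h3
      change ∀ e, f.onE (ρ e) = f.onE e at h5
      have hρ : ∀ e, ρ e = (σ e.1, e.2) := by
        intro e
        refine Prod.ext (h2 e) ?_
        have := congrArg Prod.snd (h5 e)
        rwa [hf, hf] at this
      -- Deck transformations preserve labels, hence commute with the step along the loop of voltage
      -- 1. So `σ` is translation by its value at 0.
      obtain ⟨s, hs⟩ : ∃ s : ZMod N → ZMod N, ∀ v, s v = σ v := ⟨σ, fun _ => rfl⟩
      have hs1 : ∀ v, s (v + 1) = s v + 1 := by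
        intro v
        have h6 := (congrArg (cayley N I h).t (hρ (v, i, true))).symm.trans (h3 (v, i, true))
        have h7 : displacement N h (i, true) = 1 := by simp [displacement, hi]
        have h8 : s v + displacement N h (i, true) = s (v + displacement N h (i, true)) := by
          rw [hs, hs]
          exact h6
        rw [h7] at h8
        exact h8.symm
      have hsk : ∀ k : ℕ, s k = s 0 + k := by
        intro k
        induction k with
        | zero => simp
        | succ k ih => rw [Nat.cast_succ, hs1, ih, add_assoc]
      have hsv : ∀ v : ZMod N, s 0 + v = σ v := by
        intro v
        have := hsk v.val
        rw [ZMod.natCast_zmod_val, hs v] at this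
        exact this.symm
      refine ⟨Multiplicative.ofAdd (s 0), Subtype.ext (Prod.ext ?_ ?_)⟩
      · exact Equiv.ext hsv
      · exact Equiv.ext fun e => by
          rw [hρ]
          exact Prod.ext (hsv e.1) rfl

theorem cayley_tower_label (N : ℕ → ℕ) [∀ n, NeZero (N n)] (hN : ∀ n, N n ∣ N (n + 1)) (n : ℕ)
    (e : (cayley (N n) I h).E) :
    ((towerToBase (fun n => cayley (N n) I h) (fun n => cayleyReduction h (hN n)) n).onE e).2 =
      e.2 := by
  induction n with
  | zero => rfl
  | succ n ih => exact ih _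

/-- The tower of Cayley graphs of the groups `ZMod (p ^ n)`. -/
def cayleyTower (p : ℕ) [NeZero p] {i : I} (hi : h i = 1) : UnramifiedZpCovering p where
  X := fun n => cayley (p ^ n) I h
  π := fun n => cayleyReduction h (pow_dvd_pow p n.le_succ)
  connected := fun _ => cayley_connected h hi
  unramified := fun _ => cayleyReduction_isUnramifiedCovering h _
  galois := fun n => by
    have : Subsingleton (ZMod (p ^ 0)) := by
      rw [pow_zero]
      infer_instance
    exact isGaloisCovering_of_labels (M := p ^ 0) h hi _
      (cayley_tower_label h (fun n => p ^ n) (fun n => pow_dvd_pow p n.le_succ) n)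

theorem cayleyTower_isBouquet (p : ℕ) [NeZero p] {i : I} (hi : h i = 1) :
    ((cayleyTower h p hi).X 0).IsBouquet :=
  (Nat.card_zmod (p ^ 0)).trans (pow_zero p)

end Tower

end SerreGraph

/-! ### Resultants with cyclotomic polynomials of prime power level -/

namespace Polynomial

theorem C_dvd_of_map_zmod_eq_zero {n : ℕ} {f : ℤ[X]} (hf : f.map (Int.castRingHom (ZMod n)) = 0) :
    C (n : ℤ) ∣ f := by
  rw [C_dvd_iff_dvd_coeff]
  intro i
  have := congrArg (fun g => coeff g i) hf
  simpa [coeff_map, ZMod.intCast_zmod_eq_zero_iff_dvd] using this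

/-- The resultant of a cyclotomic polynomial and `f` is the product of the values of `f` at the
primitive roots of unity. -/
theorem resultant_cyclotomic_eq_prod (m : ℕ) [NeZero m] (f : ℤ[X]) :
    (((cyclotomic m ℤ).resultant f : ℤ) : ℂ) = ∏ z ∈ primitiveRoots m ℂ, aeval z f := by
  have h1 := resultant_map_map (cyclotomic m ℤ) f (cyclotomic m ℤ).natDegree f.natDegree
    (Int.castRingHom ℂ)
  have hdeg : (cyclotomic m ℤ).natDegree = (cyclotomic m ℂ).natDegree := by
    rw [natDegree_cyclotomic, natDegree_cyclotomic]
  rw [map_cyclotomic, hdeg, resultant_eq_prod_eval _ _ _ natDegree_map_le (IsAlgClosed.splits _),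
    (cyclotomic.monic m ℂ).leadingCoeff, one_pow, one_mul,
    cyclotomic.roots_eq_primitiveRoots_val] at h1
  rw [hdeg]
  refine h1.symm.trans (Finset.prod_congr rfl fun z _ => ?_)
  rw [eval_map, aeval_def]
  rfl

theorem map_cyclotomic_prime_pow_zmod (p : ℕ) [Fact p.Prime] (k : ℕ) :
    (cyclotomic (p ^ (k + 1)) ℤ).map (Int.castRingHom (ZMod p)) =
      (X - 1) ^ (p ^ (k + 1)).totient := by
  have hp : p.Prime := Fact.out
  have := cyclotomic_mul_prime_pow_eq (ZMod p) (p := p) (m := 1) (by simpa using hp.one_lt.ne')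
    k.succ_pos
  rw [mul_one, cyclotomic_one] at this
  rw [map_cyclotomic, Nat.succ_eq_add_one] at *
  rw [this, Nat.totient_prime_pow hp k.succ_pos]
  congr 1
  simp [pow_succ, Nat.mul_sub]

/-- In the quotient by a cyclotomic polynomial of `p`-power level, the prime `p` is divisible by
powers of `X - 1`. -/
theorem exists_eq_X_sub_one_pow_mul_add_cyclotomic_mul (p : ℕ) [Fact p.Prime] (k d : ℕ)
    (hd : d ≤ (p ^ (k + 1)).totient) :
    ∃ V W : ℤ[X], C (p : ℤ) = (X - 1) ^ d * V + cyclotomic (p ^ (k + 1)) ℤ * W := by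
  have hp : p.Prime := Fact.out
  set Φ := cyclotomic (p ^ (k + 1)) ℤ with hΦ
  set t := (p ^ (k + 1)).totient with ht
  obtain ⟨T, hT⟩ : C (p : ℤ) ∣ Φ - (X - 1) ^ t := by
    refine C_dvd_of_map_zmod_eq_zero ?_
    rw [Polynomial.map_sub, hΦ, map_cyclotomic_prime_pow_zmod]
    simp [ht]
  have htpos : 0 < t := Nat.totient_pos.2 (pow_pos hp.pos _)
  have hT1 : T.eval 1 = 1 := by
    have := congrArg (eval 1) hT
    rw [eval_sub, hΦ, eval_one_cyclotomic_prime_pow] at this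
    simp only [eval_pow, eval_sub, eval_X, eval_one, sub_self, zero_pow htpos.ne', sub_zero,
      eval_mul, eval_C] at this
    have hp0 : (p : ℤ) ≠ 0 := by exact_mod_cast hp.ne_zero
    exact (mul_left_cancel₀ hp0 (by rw [← this, mul_one])).symm
  obtain ⟨U, hU⟩ : (X - 1 : ℤ[X]) ∣ 1 - T := by
    rw [← C_1, dvd_iff_isRoot]
    simp [hT1]
  induction d with
  | zero => exact ⟨C (p : ℤ), 0, by simp⟩
  | succ d ih =>
    obtain ⟨V, W, hVW⟩ := ih (Nat.le_of_succ_le hd)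
    refine ⟨-(X - 1) ^ (t - (d + 1)) + U * V, 1 + (X - 1) * U * W, ?_⟩
    have h1 : (X - 1 : ℤ[X]) ^ t = (X - 1) ^ (d + 1) * (X - 1) ^ (t - (d + 1)) := by
      rw [← pow_add, Nat.add_sub_cancel' hd]
    -- Inserting the inductive formula for `p` into `p * (1 - T)` gains a factor `X - 1`; the
    -- remaining power `t` is large enough since `d + 1 ≤ t`.
    calc C (p : ℤ) = C (p : ℤ) * T + C (p : ℤ) * (1 - T) := by ring
      _ = Φ - (X - 1) ^ t + ((X - 1) ^ d * V + Φ * W) * ((X - 1) * U) := by rw [← hT, hU, ← hVW]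
      _ = _ := by rw [h1]; ring

/-- If `f ≡ c (X - 1) ^ d` modulo `p` with `p ∤ c`, the resultant of `f` and a cyclotomic polynomial
of `p`-power level has `p`-adic valuation `d` as soon as the level is large enough. -/
theorem padicValInt_resultant_cyclotomic (p : ℕ) [Fact p.Prime] (k d : ℕ)
    (hd : d < (p ^ (k + 1)).totient) {f S : ℤ[X]} {c : ℤ} (hc : ¬ (p : ℤ) ∣ c)
    (hf : f = C c * (X - 1) ^ d + C (p : ℤ) * S) :
    padicValInt p ((cyclotomic (p ^ (k + 1)) ℤ).resultant f) = d := by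
  have hp : p.Prime := Fact.out
  obtain ⟨V, W, hVW⟩ := exists_eq_X_sub_one_pow_mul_add_cyclotomic_mul p k (d + 1) hd
  set Φ := cyclotomic (p ^ (k + 1)) ℤ with hΦ
  -- Writing `p` with exponent `d + 1` rather than `d` leaves a spare `X - 1`, so that `g` takes the
  -- value `c` at 1.
  set g : ℤ[X] := C c + (X - 1) * (V * S) with hg
  have hfg : f = (X - 1) ^ d * g + Φ * (W * S) := by
    rw [hf, hVW, hg]
    ring
  have hres : Φ.resultant f = Φ.resultant (X - 1) ^ d * Φ.resultant g := by
    have : ((Φ.resultant f : ℤ) : ℂ) = ((Φ.resultant (X - 1) ^ d * Φ.resultant g : ℤ) : ℂ) := by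
      rw [Int.cast_mul, Int.cast_pow, hΦ, resultant_cyclotomic_eq_prod,
        resultant_cyclotomic_eq_prod, resultant_cyclotomic_eq_prod, ← Finset.prod_pow,
        ← Finset.prod_mul_distrib]
      refine Finset.prod_congr rfl fun z hz => ?_
      have hz0 : aeval z Φ = 0 := by
        rw [hΦ, aeval_def, eval₂_eq_eval_map, map_cyclotomic]
        exact isRoot_cyclotomic_iff.2 (isPrimitiveRoot_of_mem_primitiveRoots hz)
      rw [hfg]
      simp [hz0]
    exact_mod_cast this
  have hX : (Φ.resultant (X - 1)).natAbs = p := by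
    have h1 : (X - 1 : ℤ[X]).natDegree = 1 := by
      rw [← C_1, natDegree_X_sub_C]
    rw [h1, ← C_1, resultant_X_sub_C_right _ _ _ le_rfl, hΦ, eval_one_cyclotomic_prime_pow,
      Int.natAbs_mul, Int.natAbs_pow]
    simp
  -- Modulo `p`, `Φ` is a power of `X - 1`, so the resultant is a power of `g(1) = c`.
  have hgp : ¬ (p : ℤ) ∣ Φ.resultant g := by
    intro hdvd
    have h1 := resultant_map_map Φ g Φ.natDegree g.natDegree (Int.castRingHom (ZMod p))
    have h2 : Int.castRingHom (ZMod p) (Φ.resultant g) = 0 :=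
      (ZMod.intCast_zmod_eq_zero_iff_dvd _ _).2 hdvd
    rw [h2, hΦ, map_cyclotomic_prime_pow_zmod, natDegree_cyclotomic, ← C_1,
      resultant_X_sub_C_pow_left _ _ _ _ natDegree_map_le] at h1
    have h3 := eq_zero_of_pow_eq_zero h1
    rw [hg] at h3
    simp only [Polynomial.map_add, Polynomial.map_mul, Polynomial.map_sub, map_X,
      Polynomial.map_one, map_C, eval_add, eval_mul, eval_sub, eval_X, eval_one, sub_self,
      zero_mul, add_zero, eval_C] at h3
    exact hc ((ZMod.intCast_zmod_eq_zero_iff_dvd _ _).1 h3)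
  have hg0 : Φ.resultant g ≠ 0 := fun h => hgp (h ▸ dvd_zero _)
  have hX0 : Φ.resultant (X - 1) ≠ 0 := fun h => hp.ne_zero (by rw [← hX, h]; rfl)
  rw [hres, padicValInt.mul (pow_ne_zero _ hX0) hg0, padicValInt.eq_zero_of_not_dvd hgp, add_zero,
    padicValInt, Int.natAbs_pow, hX, padicValNat.prime_pow]

/-- A polynomial which is nonzero modulo a prime `l` different from `p` has resultant prime to `l`
with all cyclotomic polynomials of large `p`-power level. -/
theorem eventually_not_dvd_resultant_cyclotomic {p l : ℕ} (hp : p.Prime) (hl : l.Prime)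
    (hlp : l ≠ p) {f : ℤ[X]} (hf : f.map (Int.castRingHom (ZMod l)) ≠ 0) :
    ∀ᶠ n : ℕ in Filter.atTop, ¬ (l : ℤ) ∣ (cyclotomic (p ^ n) ℤ).resultant f := by
  have : Fact l.Prime := ⟨hl⟩
  let K := AlgebraicClosure (ZMod l)
  have : CharP K l := charP_of_injective_algebraMap (algebraMap (ZMod l) K).injective l
  set g : K[X] := f.map (Int.castRingHom K) with hg
  have hg0 : g ≠ 0 := by
    have : g = (f.map (Int.castRingHom (ZMod l))).map (algebraMap (ZMod l) K) := by
      rw [hg, Polynomial.map_map]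
      congr 1
    rw [this]
    exact (Polynomial.map_ne_zero_iff (algebraMap (ZMod l) K).injective).2 hf
  classical
  -- A common root in characteristic `l ≠ p` has order `p ^ n > n`, impossible once `n` reaches the
  -- largest order of a root of `g`.
  refine Filter.eventually_atTop.2 ⟨g.roots.toFinset.sup orderOf, fun n hn hdvd => ?_⟩
  have h1 := resultant_map_map (cyclotomic (p ^ n) ℤ) f (cyclotomic (p ^ n) ℤ).natDegree f.natDegree
    (Int.castRingHom K)
  have h2 : Int.castRingHom K ((cyclotomic (p ^ n) ℤ).resultant f) = 0 :=
    (CharP.intCast_eq_zero_iff K l _).2 hdvd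
  have hdeg : (cyclotomic (p ^ n) ℤ).natDegree = (cyclotomic (p ^ n) K).natDegree := by
    rw [natDegree_cyclotomic, natDegree_cyclotomic]
  rw [h2, map_cyclotomic, hdeg, resultant_eq_prod_eval _ _ _ natDegree_map_le
    (IsAlgClosed.splits _), (cyclotomic.monic (p ^ n) K).leadingCoeff, one_pow, one_mul,
    Multiset.prod_eq_zero_iff, Multiset.mem_map] at h1
  obtain ⟨x, hx, hx0⟩ := h1
  have hne : NeZero ((p ^ n : ℕ) : K) := ⟨by
    rw [Ne, CharP.cast_eq_zero_iff K l]
    intro h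
    exact hlp ((Nat.prime_dvd_prime_iff_eq hl hp).1 (hl.dvd_of_dvd_pow h))⟩
  have hprim : IsPrimitiveRoot x (p ^ n) := isRoot_cyclotomic_iff.1 (isRoot_of_mem_roots hx)
  have hmem : x ∈ g.roots.toFinset := by
    rw [Multiset.mem_toFinset, mem_roots hg0]
    exact hx0
  have h3 := Finset.le_sup (f := orderOf) hmem
  rw [← hprim.eq_orderOf] at h3
  exact absurd (Nat.lt_pow_self hp.one_lt (n := n)) (not_lt.2 (h3.trans hn))

end Polynomial

/-! ### The loop polynomial -/

namespace Polynomial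

/-- The numerator of the Laurent polynomial
`∑ i < j, binom (2 j) i * (p - 1) ^ i * (2 - X ^ (j - i) - X ^ (i - j))`. -/
noncomputable def loopPolynomial (j : ℕ) (c : ℤ) : ℤ[X] :=
  ∑ i ∈ range j, C (((2 * j).choose i : ℤ) * c ^ i) * (2 * X ^ j - X ^ i - X ^ (2 * j - i))

/-- The coefficients of (X - 1)^(2j) are symmetric, so the terms i and 2j - i pair up; vanishing at
1 expresses the middle coefficient as -2 times the sum of the earlier ones. -/
theorem loopPolynomial_neg_one {j : ℕ} (hj : 0 < j) :
    loopPolynomial j (-1) = -(X - 1) ^ (2 * j) := by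
  set u : ℕ → ℤ[X] := fun i => C (((2 * j).choose i : ℤ) * (-1) ^ i) with hu
  have hsymm : ∀ i ∈ range j, u (2 * j - i) = u i := by
    intro i hi
    have hi' : i ≤ 2 * j := by
      have := mem_range.1 hi
      omega
    simp only [hu]
    rw [Nat.choose_symm hi']
    congr 2
    rw [neg_one_pow_eq_pow_mod_two, neg_one_pow_eq_pow_mod_two (n := i)]
    congr 1
    omega
  have hbin : (X - 1 : ℤ[X]) ^ (2 * j) = ∑ i ∈ range (2 * j + 1), u i * X ^ i := by
    rw [sub_eq_neg_add, add_pow]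
    rw [← Finset.sum_range_reflect]
    refine Finset.sum_congr rfl fun i hi => ?_
    have hi' : i ≤ 2 * j := Nat.lt_succ_iff.1 (mem_range.1 hi)
    have e1 : 2 * j + 1 - 1 - i = 2 * j - i := by omega
    have e2 : 2 * j - (2 * j - i) = i := by omega
    have e3 : (-1 : ℤ[X]) ^ (2 * j - i) = (-1) ^ i := by
      rw [neg_one_pow_eq_pow_mod_two, neg_one_pow_eq_pow_mod_two (n := i)]
      congr 1
      omega
    rw [e1, e2, e3, Nat.choose_symm hi']
    simp only [hu, C_mul, C_pow, C_neg, C_1, map_natCast]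
    ring
  have hsplit : ∀ v : ℤ[X], ∑ i ∈ range (2 * j + 1), u i * v ^ i =
      ∑ i ∈ range j, u i * v ^ i + u j * v ^ j + ∑ i ∈ range j, u i * v ^ (2 * j - i) := by
    intro v
    rw [show 2 * j + 1 = (j + 1) + j by ring, Finset.sum_range_add, Finset.sum_range_succ]
    congr 1
    rw [← Finset.sum_range_reflect]
    refine Finset.sum_congr rfl fun i hi => ?_
    have e : j + 1 + (j - 1 - i) = 2 * j - i := by
      have := mem_range.1 hi
      omega
    rw [e, hsymm i hi]
  have hone : (0 : ℤ[X]) = 2 * ∑ i ∈ range j, u i + u j := by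
    have h0 : (0 : ℤ[X]) = ∑ i ∈ range (2 * j + 1), u i * 1 ^ i := by
      have := congrArg (fun f : ℤ[X] => C (eval 1 f)) hbin
      simp only [eval_pow, eval_sub, eval_X, eval_one, sub_self, eval_finsetSum, eval_mul] at this
      rw [zero_pow (by omega), C_0, map_sum] at this
      refine this.trans (Finset.sum_congr rfl fun i _ => ?_)
      simp [hu]
    rw [h0, hsplit]
    simp only [one_pow, mul_one]
    ring
  have hl : loopPolynomial j (-1) = 2 * (∑ i ∈ range j, u i) * X ^ j -
      ∑ i ∈ range j, u i * X ^ i - ∑ i ∈ range j, u i * X ^ (2 * j - i) := by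
    rw [loopPolynomial, Finset.mul_sum, Finset.sum_mul, ← Finset.sum_sub_distrib,
      ← Finset.sum_sub_distrib]
    refine Finset.sum_congr rfl fun i _ => ?_
    simp only [hu]
    ring
  rw [hl, hbin, hsplit]
  linear_combination -X ^ j * hone

/-- Replacing -1 by `p - 1` changes nothing mod `p`, but makes the coefficients usable as numbers of
loops. -/
theorem loopPolynomial_eq_add {j p : ℕ} (hj : 0 < j) :
    ∃ S, loopPolynomial j ((p : ℤ) - 1) = C (-1) * (X - 1) ^ (2 * j) + C (p : ℤ) * S := by
  have hdvd : C (p : ℤ) ∣ loopPolynomial j ((p : ℤ) - 1) - loopPolynomial j (-1) := by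
    rw [loopPolynomial, loopPolynomial, ← Finset.sum_sub_distrib]
    refine Finset.dvd_sum fun i _ => ?_
    rw [← sub_mul, ← C_sub, ← mul_sub]
    refine Dvd.dvd.mul_right (_root_.map_dvd C ?_) _
    refine Dvd.dvd.mul_left ?_ _
    simpa using sub_dvd_pow_sub_pow ((p : ℤ) - 1) (-1) i
  obtain ⟨S, hS⟩ := hdvd
  refine ⟨S, ?_⟩
  rw [← hS, loopPolynomial_neg_one hj]
  simp

/-- Only i = 0 contributes to the constant coefficient, which is -1. -/
theorem loopPolynomial_map_ne_zero {j l : ℕ} (hj : 0 < j) (hl : l.Prime) (c : ℤ) :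
    (loopPolynomial j c).map (Int.castRingHom (ZMod l)) ≠ 0 := by
  have : Fact l.Prime := ⟨hl⟩
  have h0 : (loopPolynomial j c).eval 0 = -1 := by
    rw [loopPolynomial, eval_finsetSum, Finset.sum_eq_single 0]
    · simp [hj.ne']
    · intro i hi hi0
      have := mem_range.1 hi
      simp [hj.ne', hi0, show 2 * j - i ≠ 0 by omega]
    · intro h
      exact absurd (mem_range.2 hj) h
  intro h
  have h1 := congrArg (eval 0) h
  rw [eval_zero, ← map_zero (Int.castRingHom (ZMod l)), eval_map, eval₂_hom, h0] at h1
  simp at h1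

end Polynomial

/-! ### Tree count for the chosen loops -/

/-- The multiset of loops: `M * binom (2 j) i * c ^ i` loops with index `i` for `i < j`. -/
abbrev LoopIndex (j M c : ℕ) : Type := Σ i : Fin j, Fin (M * ((2 * j).choose i * c ^ (i : ℕ)))

/-- The voltage of a loop. -/
def loopVoltage (j M c : ℕ) (x : LoopIndex j M c) : ℕ := j - x.1

namespace SerreGraph

open Polynomial

theorem exists_loopVoltage_eq_one {j M c : ℕ} (hj : 0 < j) (hM : 0 < M) (hc : 0 < c) :
    ∃ x, loopVoltage j M c x = 1 := by
  refine ⟨⟨⟨j - 1, by omega⟩, ⟨0, ?_⟩⟩, ?_⟩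
  · exact Nat.mul_pos hM (Nat.mul_pos (Nat.choose_pos (by simp; omega)) (pow_pos hc _))
  · simp only [loopVoltage]
    omega

theorem cayleyEigenvalue_loopVoltage (j M c : ℕ) {z : ℂ} (hz : z ≠ 0) :
    z ^ j * cayleyEigenvalue (loopVoltage j M c) z = M * aeval z (loopPolynomial j c) := by
  rw [cayleyEigenvalue, Fintype.sum_sigma, loopPolynomial, map_sum, Finset.mul_sum, Finset.mul_sum,
    ← Fin.sum_univ_eq_sum_range (fun i => (M : ℂ) * aeval z
      (C (((2 * j).choose i : ℤ) * (c : ℤ) ^ i) * (2 * X ^ j - X ^ i - X ^ (2 * j - i)) : ℤ[X]))]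
  refine Finset.sum_congr rfl fun i _ => ?_
  have hi : (i : ℕ) ≤ j := i.2.le
  have e1 : z ^ j * z ^ (j - (i : ℕ)) = z ^ (2 * j - (i : ℕ)) := by
    rw [← pow_add]
    congr 1
    omega
  have e2 : z ^ j * z⁻¹ ^ (j - (i : ℕ)) = z ^ (i : ℕ) := by
    rw [inv_pow, ← div_eq_mul_inv, div_eq_iff (pow_ne_zero _ hz), ← pow_add]
    congr 1
    omega
  simp only [loopVoltage, Finset.sum_const, card_univ, Fintype.card_fin, nsmul_eq_mul]
  simp only [map_mul, map_sub, map_pow, aeval_X, map_ofNat, map_natCast, Nat.cast_mul,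
    Nat.cast_pow]
  linear_combination (-(M : ℂ) * (((2 * j).choose i) * c ^ (i : ℕ))) * (e1 + e2)

/-- Every summand has real part 2(1 - Re z^k) ≥ 0, and the one of voltage 1 is positive unless z =
1. -/
theorem cayleyEigenvalue_ne_zero {I : Type} [Fintype I] (h : I → ℕ) {i : I} (hi : h i = 1) {z : ℂ}
    (hz : ‖z‖ = 1) (hz1 : z ≠ 1) : cayleyEigenvalue h z ≠ 0 := by
  have hterm : ∀ k, (2 - z ^ k - z⁻¹ ^ k : ℂ).re = 2 * (1 - (z ^ k).re) := by
    intro k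
    have : (z⁻¹ ^ k).re = (z ^ k).re := by
      rw [Complex.inv_eq_conj hz, ← map_pow, Complex.conj_re]
    simp only [Complex.sub_re, this, Complex.re_ofNat]
    ring
  have hnn : ∀ k, 0 ≤ 1 - (z ^ k).re := by
    intro k
    have := Complex.re_le_norm (z ^ k)
    rw [norm_pow, hz, one_pow] at this
    linarith
  intro h0
  have h1 := congrArg Complex.re h0
  rw [cayleyEigenvalue, Complex.re_sum, Complex.zero_re,
    Finset.sum_eq_zero_iff_of_nonneg fun i _ => by
      rw [hterm]
      exact mul_nonneg zero_le_two (hnn _)] at h1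
  have h2 := h1 i (mem_univ i)
  rw [hterm, hi, pow_one] at h2
  have hre : z.re = 1 := by linarith
  have him : z.im = 0 := by
    have := Complex.sq_norm z
    rw [hz, Complex.normSq_apply, hre] at this
    have : z.im * z.im = 0 := by linarith
    exact mul_self_eq_zero.1 this
  exact hz1 (Complex.ext hre him)

theorem nthRootsFinset_prime_pow_erase_one {p : ℕ} (hp : p.Prime) (n : ℕ) (f : ℂ → ℝ) :
    ∏ z ∈ (nthRootsFinset (p ^ n) (1 : ℂ)).erase 1, f z =
      ∏ i ∈ range n, ∏ z ∈ primitiveRoots (p ^ (i + 1)) ℂ, f z := by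
  classical
  have hset : (nthRootsFinset (p ^ n) (1 : ℂ)).erase 1 =
      (range n).biUnion fun i => primitiveRoots (p ^ (i + 1)) ℂ := by
    ext z
    have hpos : ∀ k, 0 < p ^ k := fun k => pow_pos hp.pos k
    simp only [mem_erase, mem_nthRootsFinset (hpos n), mem_biUnion, mem_range,
      mem_primitiveRoots (hpos _)]
    constructor
    · rintro ⟨hz1, hz⟩
      obtain ⟨k, hk, hord⟩ := (Nat.dvd_prime_pow hp).1 (orderOf_dvd_of_pow_eq_one hz)
      rcases k with _ | k
      · rw [pow_zero, orderOf_eq_one_iff] at hord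
        exact absurd hord hz1
      · exact ⟨k, hk, hord ▸ IsPrimitiveRoot.orderOf z⟩
    · rintro ⟨k, hk, hz⟩
      refine ⟨fun h1 => ?_, (hz.pow_eq_one_iff_dvd _).2 (pow_dvd_pow p hk)⟩
      rw [h1] at hz
      have := hz.unique IsPrimitiveRoot.one
      exact (Nat.one_lt_pow k.succ_ne_zero hp.one_lt).ne' this
  rw [hset, Finset.prod_biUnion]
  intro a _ b _ hab
  refine Finset.disjoint_left.2 fun z hza hzb => hab ?_
  have := (isPrimitiveRoot_of_mem_primitiveRoots hza).unique
    (isPrimitiveRoot_of_mem_primitiveRoots hzb)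
  exact Nat.succ_injective (Nat.pow_right_injective hp.two_le this)

theorem norm_eq_one_of_mem_primitiveRoots {m : ℕ} (hm : m ≠ 0) {z : ℂ}
    (hz : z ∈ primitiveRoots m ℂ) : ‖z‖ = 1 :=
  (isPrimitiveRoot_of_mem_primitiveRoots hz).norm'_eq_one hm

theorem resultant_cyclotomic_loopPolynomial_ne_zero {p j c : ℕ} (hp : p.Prime) (hj : 0 < j)
    (hc : 0 < c) (n : ℕ) : (cyclotomic (p ^ (n + 1)) ℤ).resultant (loopPolynomial j c) ≠ 0 := by
  have : NeZero p := ⟨hp.ne_zero⟩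
  obtain ⟨x, hx⟩ := exists_loopVoltage_eq_one (M := 1) hj one_pos hc
  intro h0
  have h1 := resultant_cyclotomic_eq_prod (p ^ (n + 1)) (loopPolynomial j c)
  rw [h0, Int.cast_zero, eq_comm, Finset.prod_eq_zero_iff] at h1
  obtain ⟨z, hz, hz0⟩ := h1
  have hm : p ^ (n + 1) ≠ 0 := pow_ne_zero _ hp.ne_zero
  have hnorm := norm_eq_one_of_mem_primitiveRoots hm hz
  have hzne : z ≠ 0 := by
    rintro rfl
    simp at hnorm
  have h2 := cayleyEigenvalue_loopVoltage j 1 c hzne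
  rw [hz0, mul_zero] at h2
  refine cayleyEigenvalue_ne_zero _ hx hnorm ?_ ((mul_eq_zero.1 h2).resolve_left
    (pow_ne_zero _ hzne))
  exact (isPrimitiveRoot_of_mem_primitiveRoots hz).ne_one
    (Nat.one_lt_pow n.succ_ne_zero hp.one_lt)

/-- Absolute values remove the factors z^j. Each of the p^n - 1 nontrivial characters contributes
one `M`. -/
theorem pow_mul_numSpanningTrees_loops {p : ℕ} (hp : p.Prime) [NeZero p] (j M c n : ℕ) :
    p ^ n * (cayley (p ^ n) (LoopIndex j M c) (loopVoltage j M c)).numSpanningTrees =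
      M ^ (p ^ n - 1) * ∏ i ∈ range n,
        ((cyclotomic (p ^ (i + 1)) ℤ).resultant (loopPolynomial j c)).natAbs := by
  have hpn : p ^ n ≠ 0 := pow_ne_zero _ hp.ne_zero
  have h1 := congrArg norm (card_mul_numSpanningTrees_cayley (N := p ^ n) (loopVoltage j M c))
  have hterm : ∀ z ∈ (nthRootsFinset (p ^ n) (1 : ℂ)).erase 1,
      ‖cayleyEigenvalue (loopVoltage j M c) z‖ = M * ‖aeval z (loopPolynomial j c)‖ := by
    intro z hz
    have hzn : z ^ (p ^ n) = 1 :=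
      (mem_nthRootsFinset (pow_pos hp.pos n) _).1 (mem_of_mem_erase hz)
    have hnorm : ‖z‖ = 1 := Complex.norm_eq_one_of_pow_eq_one hzn hpn
    have hzne : z ≠ 0 := by
      rintro rfl
      simp at hnorm
    have h2 := congrArg norm (cayleyEigenvalue_loopVoltage j M c hzne)
    rwa [norm_mul, norm_pow, hnorm, one_pow, one_mul, norm_mul, Complex.norm_natCast] at h2
  have hcard : ((nthRootsFinset (p ^ n) (1 : ℂ)).erase 1).card = p ^ n - 1 := by
    rw [card_erase_of_mem (one_mem_nthRootsFinset (pow_pos hp.pos n)),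
      (Complex.isPrimitiveRoot_exp (p ^ n) hpn).card_nthRootsFinset]
  have hres : ∀ i, ∏ z ∈ primitiveRoots (p ^ (i + 1)) ℂ, ‖aeval z (loopPolynomial j c)‖ =
      ((cyclotomic (p ^ (i + 1)) ℤ).resultant (loopPolynomial j c)).natAbs := by
    intro i
    rw [← norm_prod, ← resultant_cyclotomic_eq_prod, Complex.norm_intCast, Nat.cast_natAbs,
      Int.cast_abs]
  rw [norm_prod, Finset.prod_congr rfl hterm, Finset.prod_mul_distrib, Finset.prod_const, hcard,
    nthRootsFinset_prime_pow_erase_one hp, Finset.prod_congr rfl fun i _ => hres i, norm_mul,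
    Complex.norm_natCast, Complex.norm_natCast] at h1
  exact_mod_cast h1

end SerreGraph

/-! ### Valuations and conclusion -/

theorem exists_eventually_sum_range_eq {u : ℕ → ℕ} {c : ℕ} (hu : ∀ᶠ n in Filter.atTop, u n = c) :
    ∃ ν : ℤ, ∀ᶠ n : ℕ in Filter.atTop, ((∑ i ∈ range n, u i : ℕ) : ℤ) = c * n + ν := by
  obtain ⟨N, hN⟩ := Filter.eventually_atTop.1 hu
  refine ⟨(∑ i ∈ range N, u i : ℕ) - c * N, Filter.eventually_atTop.2 ⟨N, fun n hn => ?_⟩⟩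
  induction n, hn using Nat.le_induction with
  | base => ring
  | succ n hn ih =>
    rw [Finset.sum_range_succ, Nat.cast_add, ih, hN n hn]
    push_cast
    ring

theorem exists_pos_padicValNat_eq (mu : ℕ → ℕ) (hmu : {l : ℕ | l.Prime ∧ mu l ≠ 0}.Finite) :
    ∃ M : ℕ, 0 < M ∧ ∀ l : ℕ, l.Prime → padicValNat l M = mu l := by
  classical
  let f : ℕ →₀ ℕ := Finsupp.onFinset hmu.toFinset (fun l => if l.Prime then mu l else 0) (by
    intro l hl
    simpa using hl)
  have hf : ∀ q ∈ f.support, q.Prime := by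
    intro q hq
    by_contra h
    simp [f, h] at hq
  refine ⟨f.prod (· ^ ·), ?_, fun l hl => ?_⟩
  · exact Finset.prod_pos fun q hq => pow_pos (hf q hq).pos _
  · rw [← Nat.factorization_def _ hl, Nat.prod_pow_factorization_eq_self hf]
    simp [f, hl]

theorem theorem5p2 (p : ℕ) (hp : p.Prime) (lam : ℕ) (hlam : Odd lam)
    (mu : ℕ → ℕ) (hmu : {l : ℕ | l.Prime ∧ mu l ≠ 0}.Finite) :
    ∃ C : UnramifiedZpCovering p, (C.X 0).IsBouquet ∧
      C.HasInvariants lam (mu p) ∧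
      ∀ l : ℕ, l.Prime → l ≠ p → C.HasMuInvariant l (mu l) := by
  have : NeZero p := ⟨hp.ne_zero⟩
  have hpf : Fact p.Prime := ⟨hp⟩
  obtain ⟨M, hM, hMval⟩ := exists_pos_padicValNat_eq mu hmu
  obtain ⟨j', hj'⟩ := hlam
  -- Chosen so that `lam = 2 * j - 1`.
  obtain ⟨j, hjdef⟩ : ∃ j, j = j' + 1 := ⟨_, rfl⟩
  have hj : 0 < j := by omega
  obtain ⟨c, hcdef⟩ : ∃ c, c = p - 1 := ⟨_, rfl⟩
  have hc : 0 < c := by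
    have := hp.two_le
    omega
  have hcp : (c : ℤ) = p - 1 := by
    rw [hcdef, Nat.cast_sub hp.one_le, Nat.cast_one]
  obtain ⟨x, hx⟩ := SerreGraph.exists_loopVoltage_eq_one (j := j) (M := M) (c := c) hj hM hc
  let R : ℕ → ℤ := fun i =>
    (Polynomial.cyclotomic (p ^ (i + 1)) ℤ).resultant (Polynomial.loopPolynomial j c)
  have hR : ∀ i, (R i).natAbs ≠ 0 := fun i => Int.natAbs_ne_zero.2
    (SerreGraph.resultant_cyclotomic_loopPolynomial_ne_zero hp hj hc i)
  let C := SerreGraph.cayleyTower (loopVoltage j M c) p hx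
  have hκ : ∀ n, p ^ n * (C.X n).numSpanningTrees =
      M ^ (p ^ n - 1) * ∏ i ∈ range n, (R i).natAbs :=
    SerreGraph.pow_mul_numSpanningTrees_loops hp j M c
  -- The term `n * padicValNat l p` comes from the group order: it lowers the slope from 2j to 2j -
  -- 1 at l = p and vanishes otherwise.
  have hval : ∀ l : ℕ, l.Prime → ∀ n, (n * padicValNat l p + padicValNat l (C.X n).numSpanningTrees :
      ℤ) = mu l * ((p : ℤ) ^ n - 1) + (∑ i ∈ range n, padicValNat l (R i).natAbs : ℕ) := by
    intro l hl n
    have : Fact l.Prime := ⟨hl⟩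
    have hprod : ∏ i ∈ range n, (R i).natAbs ≠ 0 := Finset.prod_ne_zero_iff.2 fun i _ => hR i
    have hMn : M ^ (p ^ n - 1) ≠ 0 := pow_ne_zero _ hM.ne'
    have hpn : p ^ n ≠ 0 := pow_ne_zero _ hp.ne_zero
    have hκ0 : (C.X n).numSpanningTrees ≠ 0 := by
      intro h0
      have := hκ n
      rw [h0, mul_zero] at this
      exact mul_ne_zero hMn hprod this.symm
    have h1 := congrArg (padicValNat l) (hκ n)
    have h2 : padicValNat l (∏ i ∈ range n, (R i).natAbs) =
        ∑ i ∈ range n, padicValNat l (R i).natAbs := by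
      simp only [← Nat.factorization_def _ hl]
      rw [Nat.factorization_prod fun i _ => hR i, Finsupp.finsetSum_apply]
    rw [padicValNat.mul hpn hκ0, padicValNat.mul hMn hprod, padicValNat.pow,
      padicValNat.pow, hMval l hl, h2] at h1
    have h3 := congrArg (Nat.cast (R := ℤ)) h1
    rw [Nat.cast_add, Nat.cast_add, Nat.cast_mul, Nat.cast_mul,
      Nat.cast_sub (Nat.one_le_iff_ne_zero.2 hpn)] at h3
    rw [h3]
    push_cast
    ring
  refine ⟨C, SerreGraph.cayleyTower_isBouquet _ p hx, ?_, ?_⟩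
  · have hev : ∀ᶠ i in Filter.atTop, padicValNat p (R i).natAbs = 2 * j := by
      obtain ⟨S, hS⟩ := Polynomial.loopPolynomial_eq_add (p := p) hj
      rw [← hcp] at hS
      -- The bound works because φ(p^(i+1)) ≥ p^i > i ≥ 2j.
      refine Filter.eventually_atTop.2 ⟨2 * j, fun i hi => ?_⟩
      refine Polynomial.padicValInt_resultant_cyclotomic p i (2 * j) ?_ ?_ hS
      · rw [Nat.totient_prime_pow hp i.succ_pos]
        refine (hi.trans_lt (Nat.lt_pow_self hp.one_lt)).trans_le ?_
        exact Nat.le_mul_of_pos_right _ (by have := hp.two_le; omega)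
      · rw [dvd_neg]
        exact (Nat.prime_iff_prime_int.1 hp).not_dvd_one
    obtain ⟨ν, hν⟩ := exists_eventually_sum_range_eq hev
    refine ⟨ν - mu p, hν.mono fun n hn => ?_⟩
    have h1 := hval p hp n
    rw [hn, padicValNat_self] at h1
    have hlj : (lam : ℤ) = 2 * j - 1 := by
      rw [hj', hjdef]
      push_cast
      ring
    rw [hlj]
    simp only [Nat.cast_mul, Nat.cast_ofNat, Nat.cast_one] at h1
    linear_combination h1
  · intro l hl hlp
    have : Fact l.Prime := ⟨hl⟩
    have hev : ∀ᶠ i in Filter.atTop, padicValNat l (R i).natAbs = 0 := by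
      have h1 := Polynomial.eventually_not_dvd_resultant_cyclotomic hp hl hlp
        (Polynomial.loopPolynomial_map_ne_zero hj hl c)
      refine ((Filter.tendsto_add_atTop_nat 1).eventually h1).mono fun i hi => ?_
      refine padicValNat.eq_zero_of_not_dvd fun h => hi ?_
      exact Int.natCast_dvd.2 h
    obtain ⟨ν, hν⟩ := exists_eventually_sum_range_eq hev
    refine ⟨ν - mu l, hν.mono fun n hn => ?_⟩
    have h1 := hval l hl n
    rw [hn, padicValNat_primes hlp] at h1
    rw [Nat.cast_zero] at h1
    linear_combination h1
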